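/- Let $U\subset\mathbb C^n$ be open and stable under multiplication by $\mathbb C^*$, and let $V:U\to\mathbb C$ be holomorphic and homogeneous of degree $-2$, i.e. $V(sq)=s^{-2}V(q)$ for all $s\in\mathbb C^*$, $q\in U$. Let $d\in U$, $d\neq 0$, be a proper Darboux point of $V$: $V'(d)=\gamma d$ with $\gamma\in\mathbb C^*$, where $V'=\operatorname{grad}V$. Let $\varphi$ be any solution, holomorphic and non-vanishing near a point $t_0\in\mathbb C$, of $$\dot\varphi=\psi,\qquad \dot\psi=-\gamma\varphi^{-3},$$ so that $x_0(t)=(\varphi(t)d,\psi(t)d)$ is a solution of Hamilton's equations $\dot q=p,\ \dot p=-V'(q)$, lying on a phase curve $\frac12\psi^2-\frac{\gamma}{2}\varphi^{-2}=e$, with $e\in\mathbb C$ arbitrary. Put $K=\mathbb C(\varphi,\dot\varphi)$, a differential field of germs of meromorphic functions at $t_0$. For $p\in\mathbb N$ let $\mathrm{VE}_p$ be the system of variational equations up to order $p$ along $x_0$: the equations for $x_1,\dots,x_p$ obtained by inserting $x_0+\varepsilon x_1+\frac{\varepsilon^2}{2!}x_2+\cdots+\frac{\varepsilon^p}{p!}x_p$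 into Hamilton's equations and equating the coefficients of $\varepsilon,\dots,\varepsilon^p$. Its Picard–Vessiot extension $\mathrm{PV}(\mathrm{VE}_p)/K$ is the differential field generated over $K$ by the components of all its solutions $(x_1,\dots,x_p)$ holomorphic at $t_0$, and its differential Galois group is the group of all automorphisms of the field $\mathrm{PV}(\mathrm{VE}_p)$ over $K$ that commute with $\frac{d}{dt}$. Then for every $p\in\mathbb N$: 1. The differential Galois group of $\mathrm{VE}_p$ is Abelian. 2. Let $I$ be any primitive of $2/\varphi^2$ near $t_0$, let $E_\omega=\exp(\omega I)$ for $\omega\in\mathbb C$, and let $\mathcal B$ be the complex vector space spanned by the functions $I^mE_\omega$, $m\in\mathbb N$ (including $m=0$), $\omega\in\mathbb C$. Then for every solution $(x_1,\dots,x_p)$ of $\mathrm{VE}_p$ that is holomorphic at $t_0$, with $x_j=(q_j,p_j)$, one has $q_j\in\varphi\,\mathcal B^n$ near $t_0$ for $1\le j\le p$. -/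

import Mathlib

open Filter Topology
open scoped Differential

noncomputable section

/-! ## The differential field of germs of meromorphic functions at a point -/

/-- Germs at `z` of functions meromorphic at `z`, as a subring of the ring of germs of all
complex functions on punctured neighbourhoods of `z`. -/
def meroSubring (z : ℂ) : Subring (Germ (𝓝[≠] z) ℂ) where
  carrier := {g | ∃ f : ℂ → ℂ, MeromorphicAt f z ∧ g = (f : Germ (𝓝[≠] z) ℂ)}
  mul_mem' := by
    rintro _ _ ⟨f, hf, rfl⟩ ⟨g, hg, rfl⟩
    exact ⟨f * g, hf.mul hg, rfl⟩
  one_mem' := ⟨fun _ => 1, MeromorphicAt.const 1 z, rfl⟩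
  add_mem' := by
    rintro _ _ ⟨f, hf, rfl⟩ ⟨g, hg, rfl⟩
    exact ⟨f + g, hf.add hg, rfl⟩
  zero_mem' := ⟨fun _ => 0, MeromorphicAt.const 0 z, rfl⟩
  neg_mem' := by
    rintro _ ⟨f, hf, rfl⟩
    exact ⟨-f, hf.neg, rfl⟩

/-- The field of germs of meromorphic functions at `z`. -/
abbrev Mero (z : ℂ) : Type := meroSubring z

namespace Mero

variable {z : ℂ}

theorem exists_rep (g : Mero z) : ∃ f : ℂ → ℂ, MeromorphicAt f z ∧
    (g : Germ (𝓝[≠] z) ℂ) = (f : Germ (𝓝[≠] z) ℂ) := g.2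

instance instInv : Inv (Mero z) where
  inv g := ⟨(g : Germ (𝓝[≠] z) ℂ)⁻¹, by
    obtain ⟨f, hf, h⟩ := g.exists_rep
    exact ⟨f⁻¹, hf.inv, by rw [h]; rfl⟩⟩

theorem coe_inv (g : Mero z) :
    ((g⁻¹ : Mero z) : Germ (𝓝[≠] z) ℂ) = (g : Germ (𝓝[≠] z) ℂ)⁻¹ := rfl

theorem mul_inv_cancel' (g : Mero z) (hg : g ≠ 0) : g * g⁻¹ = 1 := by
  obtain ⟨f, hf, h⟩ := g.exists_rep
  apply Subtype.ext
  change (g : Germ (𝓝[≠] z) ℂ) * (g : Germ (𝓝[≠] z) ℂ)⁻¹ = 1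
  rw [h]
  rcases hf.eventually_eq_zero_or_eventually_ne_zero with h0 | h0
  · refine absurd (Subtype.ext ?_) hg
    rw [h]
    exact Germ.coe_eq.2 h0
  · refine Germ.coe_eq.2 ?_
    filter_upwards [h0] with t ht
    exact mul_inv_cancel₀ ht

theorem inv_zero' : (0 : Mero z)⁻¹ = 0 := by
  apply Subtype.ext
  change (((fun _ => 0 : ℂ → ℂ) : Germ (𝓝[≠] z) ℂ))⁻¹ = ((fun _ => 0 : ℂ → ℂ) : Germ (𝓝[≠] z) ℂ)
  refine Germ.coe_eq.2 (Eventually.of_forall fun t => ?_)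
  exact inv_zero

instance instField : Field (Mero z) where
  inv := Inv.inv
  mul_inv_cancel := mul_inv_cancel'
  inv_zero := inv_zero'
  nnqsmul := _
  nnqsmul_def := fun _ _ => rfl
  qsmul := _
  qsmul_def := fun _ _ => rfl

/-- Constant germs. -/
def const (z : ℂ) : ℂ →+* Mero z where
  toFun c := ⟨((fun _ => c : ℂ → ℂ) : Germ (𝓝[≠] z) ℂ), fun _ => c, MeromorphicAt.const c z, rfl⟩
  map_one' := rfl
  map_mul' _ _ := rfl
  map_zero' := rfl
  map_add' _ _ := rfl

instance instAlgebra : Algebra ℂ (Mero z) := (const z).toAlgebra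

/-- The derivative on germs: the germ of `f` is sent to the germ of `deriv f`. -/
def germDeriv (z : ℂ) : Germ (𝓝[≠] z) ℂ → Germ (𝓝[≠] z) ℂ :=
  Germ.map' deriv fun _ _ h => h.nhdsNE_deriv

theorem germDeriv_coe (f : ℂ → ℂ) :
    germDeriv z (f : Germ (𝓝[≠] z) ℂ) = (deriv f : Germ (𝓝[≠] z) ℂ) := rfl

/-- The derivative `d/dt` on germs of meromorphic functions. -/
def derivFun (g : Mero z) : Mero z := ⟨germDeriv z g, by
  obtain ⟨f, hf, h⟩ := g.exists_rep
  exact ⟨deriv f, hf.deriv, by rw [h]; rfl⟩⟩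

theorem coe_derivFun (g : Mero z) :
    (derivFun g : Germ (𝓝[≠] z) ℂ) = germDeriv z g := rfl

theorem derivFun_add (g h : Mero z) : derivFun (g + h) = derivFun g + derivFun h := by
  obtain ⟨f₁, hf₁, e₁⟩ := g.exists_rep
  obtain ⟨f₂, hf₂, e₂⟩ := h.exists_rep
  apply Subtype.ext
  change germDeriv z ((g : Germ (𝓝[≠] z) ℂ) + h) = germDeriv z g + germDeriv z h
  rw [e₁, e₂]
  refine Germ.coe_eq.2 ?_
  filter_upwards [hf₁.eventually_analyticAt, hf₂.eventually_analyticAt] with t h₁ h₂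
  exact deriv_add h₁.differentiableAt h₂.differentiableAt

theorem derivFun_mul (g h : Mero z) :
    derivFun (g * h) = g * derivFun h + h * derivFun g := by
  obtain ⟨f₁, hf₁, e₁⟩ := g.exists_rep
  obtain ⟨f₂, hf₂, e₂⟩ := h.exists_rep
  apply Subtype.ext
  change germDeriv z ((g : Germ (𝓝[≠] z) ℂ) * h) = g * germDeriv z h + h * germDeriv z g
  rw [e₁, e₂]
  refine Germ.coe_eq.2 ?_
  filter_upwards [hf₁.eventually_analyticAt, hf₂.eventually_analyticAt] with t h₁ h₂
  change deriv (f₁ * f₂) t = f₁ t * deriv f₂ t + f₂ t * deriv f₁ t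
  rw [deriv_mul h₁.differentiableAt h₂.differentiableAt]
  ring

/-- Meromorphic germs form a differential field under `d/dt`. -/
instance instDifferential : Differential (Mero z) where
  deriv := Derivation.mk' (AddMonoidHom.mk' derivFun derivFun_add).toIntLinearMap
    fun a b => by simpa using derivFun_mul a b

theorem coe_deriv' (g : Mero z) : ((g′ : Mero z) : Germ (𝓝[≠] z) ℂ) = germDeriv z g := rfl

/-- The meromorphic germs at `z` represented by the functions of the set `S`. -/
def germsOf (z : ℂ) (S : Set (ℂ → ℂ)) : Set (Mero z) :=
  {g | ∃ f ∈ S, (g : Germ (𝓝[≠] z) ℂ) = (f : Germ (𝓝[≠] z) ℂ)}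

end Mero

/-! ## Differential field extensions and the differential Galois group -/

section DifferentialGalois

variable {M : Type*} [Field M] [Differential M] (K : Type*) [Field K] [Algebra K M]

/-- `K⟨S⟩`: the differential subfield of `M` generated by `S` over `K`, that is, the smallest
intermediate field of `M/K` that contains `S` and is stable under the derivation. -/
def diffAdjoin (S : Set M) : IntermediateField K M :=
  sInf {E | S ⊆ E ∧ ∀ x ∈ E, x′ ∈ E}

theorem deriv_mem_diffAdjoin (S : Set M) {x : M} (hx : x ∈ diffAdjoin K S) :
    x′ ∈ diffAdjoin K S := by
  simp only [diffAdjoin, IntermediateField.mem_sInf] at hx ⊢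
  exact fun E hE => hE.2 x (hx E hE)

theorem subset_diffAdjoin (S : Set M) : S ⊆ diffAdjoin K S := by
  intro x hx
  simp only [diffAdjoin, SetLike.mem_coe, IntermediateField.mem_sInf]
  exact fun E hE => hE.1 hx

/-- `K⟨S⟩` with the restricted derivation. -/
instance diffAdjoin.instDifferential (S : Set M) : Differential (diffAdjoin K S) where
  deriv := Derivation.mk'
    (AddMonoidHom.mk' (fun x : diffAdjoin K S => (⟨(x : M)′, deriv_mem_diffAdjoin K S x.2⟩ : diffAdjoin K S))
      fun a b => Subtype.ext (by simp)).toIntLinearMap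
    fun a b => Subtype.ext (by simp)

theorem diffAdjoin.coe_deriv (S : Set M) (x : diffAdjoin K S) :
    ((x′ : diffAdjoin K S) : M) = (x : M)′ := rfl

/-- The differential Galois group of `L/K`: the group of the field automorphisms of `L` over `K`
that commute with the derivation. -/
def diffGaloisGroup (L : Type*) [Field L] [Differential L] [Algebra K L] :
    Subgroup (L ≃ₐ[K] L) where
  carrier := {σ | ∀ x : L, σ (x′) = (σ x)′}
  mul_mem' := by
    intro σ τ hσ hτ x
    simp only [Set.mem_ofPred_eq] at hσ hτ
    rw [AlgEquiv.mul_apply, AlgEquiv.mul_apply, hτ, hσ]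
  one_mem' := fun _ => rfl
  inv_mem' := by
    intro σ hσ x
    simp only [Set.mem_ofPred_eq] at hσ
    apply σ.injective
    rw [hσ]
    simp [AlgEquiv.aut_inv]

end DifferentialGalois

/-! ## Higher variational equations -/

/-- For an autonomous system `dx/dt = v(x)` and a particular solution `x₀`, the functions
`x₁, …, x_p`, holomorphic near `t₀`, solve the variational equations up to order `p`: inserting
`x₀ + ε x₁ + ε² x₂ / 2! + ⋯ + ε^p x_p / p!` into `dx/dt = v(x)`, the terms of order `ε^j`
on both sides agree for `1 ≤ j ≤ p`. The `j`-th of these equations reads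
`dx_j/dt = v'(x₀) x_j + f_j(x₁, …, x_{j-1})`; the values `x j` for `j = 0` and `j > p` are
not used. -/
def IsVariationalSolution {ι : Type*} [Fintype ι] (v : (ι → ℂ) → (ι → ℂ)) (x₀ : ℂ → ι → ℂ)
    (t₀ : ℂ) (p : ℕ) (x : ℕ → ℂ → ι → ℂ) : Prop :=
  ∀ j ∈ Finset.Icc 1 p, AnalyticAt ℂ (x j) t₀ ∧
    ∀ᶠ t in 𝓝 t₀, deriv (x j) t =
      iteratedDeriv j (fun ε : ℂ => v (x₀ t +
        ∑ i ∈ Finset.Icc 1 p, (ε ^ i / (i.factorial : ℂ)) • x i t)) 0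

/-- The extension of the field `K` of meromorphic germs at `t₀` generated (as a differential
field) by the components of all solutions of the variational equations up to order `p`.
Where `v` is holomorphic near the point `x₀(t₀)`, these equations have a full set of solutions
among the germs at `t₀`; the only constants among the meromorphic germs are the complex numbers.
So this is the Picard-Vessiot extension of `K` for the `p`-th variational equations. -/
abbrev variationalField {ι : Type*} [Fintype ι] (v : (ι → ℂ) → (ι → ℂ)) (x₀ : ℂ → ι → ℂ)
    (t₀ : ℂ) (K : IntermediateField ℂ (Mero t₀)) (p : ℕ) : IntermediateField K (Mero t₀) :=
  diffAdjoin K (Mero.germsOf t₀ {f | ∃ x : ℕ → ℂ → ι → ℂ, IsVariationalSolution v x₀ t₀ p x ∧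
    ∃ j ∈ Finset.Icc 1 p, ∃ i : ι, f = fun t => x j t i})

/-! ## Natural Hamiltonian systems and Darboux points -/

/-- The gradient `V'(q)`, the vector of the complex partial derivatives of `V`. -/
def gradV {n : ℕ} (V : (Fin n → ℂ) → ℂ) (q : Fin n → ℂ) : Fin n → ℂ :=
  fun i => fderiv ℂ V q (Pi.single i 1)

/-- The Hamiltonian vector field of `H = (p₁² + ⋯ + p_n²) / 2 + V(q)`, that is
`dq/dt = p`, `dp/dt = -V'(q)`. Coordinates `Sum.inl i` are `q_i`, and `Sum.inr i` are `p_i`. -/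
def hamiltonField {n : ℕ} (V : (Fin n → ℂ) → ℂ) (x : Fin n ⊕ Fin n → ℂ) : Fin n ⊕ Fin n → ℂ :=
  Sum.elim (fun i => x (Sum.inr i)) (fun i => -gradV V (fun k => x (Sum.inl k)) i)

/-- The curve `(q, p) = (φ d, ψ d)` in the plane `Π(d)`. -/
def darbouxCurve {n : ℕ} (d : Fin n → ℂ) (φ ψ : ℂ → ℂ) (t : ℂ) : Fin n ⊕ Fin n → ℂ :=
  Sum.elim (fun i => φ t * d i) (fun i => ψ t * d i)

/-- The ground field `K = ℂ(φ, ψ)`, where `ψ = dφ/dt`. -/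
abbrev phaseCurveField (t₀ : ℂ) (φ ψ : ℂ → ℂ) : IntermediateField ℂ (Mero t₀) :=
  IntermediateField.adjoin ℂ (Mero.germsOf t₀ {φ, ψ})

/-- The complex vector space spanned by the functions `I^m E_ω`, `m ∈ ℕ`, `ω ∈ ℂ`, where
`E_ω = exp(ω I)`. -/
def logExpSpan (I : ℂ → ℂ) : Submodule ℂ (ℂ → ℂ) :=
  Submodule.span ℂ {f | ∃ (m : ℕ) (ω : ℂ), f = fun t => I t ^ m * Complex.exp (ω * I t)}

end

/-! Put u = q/φ, w = φp − ψq and D = (φ²/2) d/dt, so that D I = 1. As V' is homogeneous of degree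
−3, all powers of φ cancel: D u_j = w_j/2 and D w_j = (γ u_j − c_j)/2, where c_j is the j-th
ε-derivative at 0 of V'(d + Σ εⁱ u_i/i!). Since c_j is V''(d) u_j plus a polynomial in u_1, …,
u_{j−1}, each order is a linear system with constant coefficients in the variable I, forced by the
lower orders.

The span of the I^m exp(ωI) is an algebra on which every D − ω is onto, and the constants are ℂ.
Induction on j therefore keeps all u_j in this algebra (`mem_expPoly_of_linear_system`,
`IsVariationalSolution.mem_expPoly`), which is the second assertion.

For the first, each u_j lies in a finite-dimensional D-stable space. An automorphism commuting with
D scales eigenvectors of D by constants and translates solutions of D x = 1 by constants;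
generalized eigenvectors are an eigenvector times a polynomial in such an x, so any two
automorphisms commute on them (`commute_apply_of_mem_finiteDimensional`). As q = φu and p = q' with
φ in K, the u_j generate the extension as a differential field. It never matters whether I is
transcendental over K, so all energies e are treated alike. -/

noncomputable section

/-! ## Exponential polynomials in a differential field -/

section ExponentialPolynomials

variable {k F : Type*} [Field k] [Field F] [Algebra k F] (D : Derivation k F F)

/-- The linear span of the products `x ^ m * E ω`, as a subalgebra. -/
def expPoly (x : F) (E : Multiplicative k →* F) : Subalgebra k F :=
  (Submodule.span k {y | ∃ (m : ℕ) (ω : k), y = x ^ m * E (.ofAdd ω)}).toSubalgebra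
    (Submodule.subset_span ⟨0, 0, by simp⟩)
    (by
      intro a b ha hb
      have := Submodule.mul_mem_mul ha hb
      rw [Submodule.span_mul_span] at this
      refine Submodule.span_mono ?_ this
      rintro _ ⟨_, ⟨m, ω, rfl⟩, _, ⟨m', ω', rfl⟩, rfl⟩
      refine ⟨m + m', ω + ω', ?_⟩
      simp only [ofAdd_add, map_mul]
      ring)

variable {D} {x : F} {E : Multiplicative k →* F}

theorem pow_mul_mem_expPoly (m : ℕ) (ω : k) : x ^ m * E (.ofAdd ω) ∈ expPoly x E :=
  Submodule.subset_span ⟨m, ω, rfl⟩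

theorem exp_mem_expPoly (ω : k) : E (.ofAdd ω) ∈ expPoly x E := by
  simpa using pow_mul_mem_expPoly (x := x) (E := E) 0 ω

theorem expPoly_induction {P : (y : F) → y ∈ expPoly x E → Prop} (h0 : P 0 (zero_mem _))
    (hadd : ∀ a b ha hb, P a ha → P b hb → P (a + b) (add_mem ha hb))
    (hsmul : ∀ (c : k) a ha, P a ha → P (c • a) (Subalgebra.smul_mem _ ha c))
    (hgen : ∀ (m : ℕ) (ω : k), P (x ^ m * E (.ofAdd ω)) (pow_mul_mem_expPoly m ω))
    {y : F} (hy : y ∈ expPoly x E) : P y hy := by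
  have hy' : y ∈ Submodule.span k {y | ∃ (m : ℕ) (ω : k), y = x ^ m * E (.ofAdd ω)} := hy
  induction hy' using Submodule.span_induction with
  | mem y h => obtain ⟨m, ω, rfl⟩ := h; exact hgen m ω
  | zero => exact h0
  | add a b ha hb iha ihb => exact hadd a b ha hb (iha ha) (ihb hb)
  | smul c a ha iha => exact hsmul c a ha (iha ha)

/-- The truncated exponent m − 1 is harmless at m = 0, where its coefficient vanishes. -/
theorem deriv_pow_mul_exp (hx : D x = 1) (hE : ∀ ω, D (E (.ofAdd ω)) = ω • E (.ofAdd ω))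
    (m : ℕ) (ω : k) :
    D (x ^ m * E (.ofAdd ω)) =
      ω • (x ^ m * E (.ofAdd ω)) + (m : k) • (x ^ (m - 1) * E (.ofAdd ω)) := by
  simp only [Derivation.leibniz, Derivation.leibniz_pow, hx, hE, smul_eq_mul, Algebra.smul_def,
    map_natCast]
  ring_nf
  simp

/-- Undetermined coefficients: any exponential-polynomial forcing admits a particular solution of
the same kind. -/
theorem exists_expPoly_deriv_sub_smul [CharZero k] (hx : D x = 1)
    (hE : ∀ ω, D (E (.ofAdd ω)) = ω • E (.ofAdd ω)) (ω : k) {y : F} (hy : y ∈ expPoly x E) :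
    ∃ b ∈ expPoly x E, D b - ω • b = y := by
  induction hy using expPoly_induction with
  | h0 => exact ⟨0, zero_mem _, by simp⟩
  | hadd a b _ _ ha hb =>
    obtain ⟨a', ha', rfl⟩ := ha
    obtain ⟨b', hb', rfl⟩ := hb
    exact ⟨a' + b', add_mem ha' hb', by rw [map_add, smul_add]; abel⟩
  | hsmul c a _ ha =>
    obtain ⟨a', ha', rfl⟩ := ha
    exact ⟨c • a', Subalgebra.smul_mem _ ha' c, by rw [D.map_smul, smul_sub, smul_comm]⟩
  | hgen m μ =>
    by_cases hμ : μ = ω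
    · subst hμ
      -- Resonance: the power of x goes up by one.
      have hm : ((m + 1 : ℕ) : k) ≠ 0 := by exact_mod_cast m.succ_ne_zero
      refine ⟨((m + 1 : ℕ) : k)⁻¹ • (x ^ (m + 1) * E (.ofAdd μ)),
        Subalgebra.smul_mem _ (pow_mul_mem_expPoly _ _) _, ?_⟩
      rw [D.map_smul, deriv_pow_mul_exp hx hE, smul_comm μ, ← smul_sub, add_sub_cancel_left,
        smul_smul, inv_mul_cancel₀ hm, one_smul, Nat.add_sub_cancel]
    · have hne : μ - ω ≠ 0 := sub_ne_zero.2 hμ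
      -- Off resonance the leading coefficient is multiplied by μ − ω ≠ 0, and the error has lower
      -- degree in x.
      induction m with
      | zero =>
        refine ⟨(μ - ω)⁻¹ • (x ^ 0 * E (.ofAdd μ)),
          Subalgebra.smul_mem _ (pow_mul_mem_expPoly _ _) _, ?_⟩
        rw [D.map_smul, deriv_pow_mul_exp hx hE, smul_comm ω, ← smul_sub, Nat.cast_zero, zero_smul,
          add_zero, ← sub_smul, smul_smul, inv_mul_cancel₀ hne, one_smul]
      | succ m ih =>
        obtain ⟨b, hb, e⟩ := ih
        refine ⟨(μ - ω)⁻¹ • (x ^ (m + 1) * E (.ofAdd μ) - ((m + 1 : ℕ) : k) • b),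
          Subalgebra.smul_mem _ (sub_mem (pow_mul_mem_expPoly _ _) (Subalgebra.smul_mem _ hb _)) _,
          ?_⟩
        have : D (x ^ (m + 1) * E (.ofAdd μ) - ((m + 1 : ℕ) : k) • b) -
            ω • (x ^ (m + 1) * E (.ofAdd μ) - ((m + 1 : ℕ) : k) • b) =
            (μ - ω) • (x ^ (m + 1) * E (.ofAdd μ)) := by
          rw [map_sub, D.map_smul, deriv_pow_mul_exp hx hE, Nat.add_sub_cancel, ← e]
          module
        rw [D.map_smul, smul_comm ω, ← smul_sub, this, smul_smul, inv_mul_cancel₀ hne, one_smul]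

/-- A solution `y` of `y' - ω y ∈ expPoly` is itself an exponential polynomial. -/
theorem mem_expPoly_of_deriv_sub_smul_mem [CharZero k] (hx : D x = 1)
    (hE : ∀ ω, D (E (.ofAdd ω)) = ω • E (.ofAdd ω))
    (hconst : ∀ y, D y = 0 → ∃ c, algebraMap k F c = y) (ω : k) {y : F}
    (hy : D y - ω • y ∈ expPoly x E) : y ∈ expPoly x E := by
  obtain ⟨b, hb, e⟩ := exists_expPoly_deriv_sub_smul hx hE ω hy
  have hE1 : E (.ofAdd (-ω)) * E (.ofAdd ω) = 1 := by
    rw [← map_mul, ← ofAdd_add, neg_add_cancel, ofAdd_zero, map_one]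
  -- y − b solves the homogeneous equation, so dividing it by the exponential leaves a constant.
  obtain ⟨c, hc⟩ := hconst (E (.ofAdd (-ω)) * (y - b)) (by
    have : D (y - b) = ω • (y - b) := by
      rw [map_sub, smul_sub, sub_eq_sub_iff_sub_eq_sub]
      exact e.symm
    rw [Derivation.leibniz, this, hE, smul_eq_mul, smul_eq_mul, mul_smul_comm, neg_smul, mul_neg,
      mul_smul_comm, mul_comm, add_neg_cancel])
  have : y = b + c • E (.ofAdd ω) := by
    rw [Algebra.smul_def, hc, mul_right_comm, hE1, one_mul, add_sub_cancel]
  rw [this]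
  exact add_mem hb (Subalgebra.smul_mem _ (exp_mem_expPoly _) _)

/-- The components of a solution of a linear system with constant coefficients, whose right-hand
sides are exponential polynomials, are exponential polynomials. -/
theorem mem_expPoly_of_linear_system [CharZero k] [IsAlgClosed k] (hx : D x = 1)
    (hE : ∀ ω, D (E (.ofAdd ω)) = ω • E (.ofAdd ω))
    (hconst : ∀ y, D y = 0 → ∃ c, algebraMap k F c = y) {ι : Type*} [Finite ι] (y : ι → F)
    (hy : ∀ i, ∃ z ∈ Submodule.span k (Set.range y), D (y i) - z ∈ expPoly x E) (i : ι) :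
    y i ∈ expPoly x E := by
  set B : Submodule k F := Subalgebra.toSubmodule (expPoly x E) with hB
  have hDB : B ≤ B.comap (D : F →ₗ[k] F) := by
    intro z hz
    have hz' : z ∈ expPoly x E := hz
    clear hz
    induction hz' using expPoly_induction with
    | h0 => exact zero_mem _
    | hadd a b _ _ ha hb => exact add_mem ha hb
    | hsmul c a _ ha => exact Submodule.smul_mem _ _ ha
    | hgen m ω =>
      change D _ ∈ expPoly x E
      rw [deriv_pow_mul_exp hx hE]
      exact add_mem (Subalgebra.smul_mem _ (pow_mul_mem_expPoly _ _) _)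
        (Subalgebra.smul_mem _ (pow_mul_mem_expPoly _ _) _)
  -- Modulo exponential polynomials the system becomes homogeneous: D acts on the finite-dimensional
  -- image W of the span of the unknowns. It remains to show W = 0.
  let T : Module.End k (F ⧸ B) := B.mapQ B (D : F →ₗ[k] F) hDB
  have hTmk : ∀ z, T (B.mkQ z) = B.mkQ (D z) := fun z => rfl
  set W : Submodule k (F ⧸ B) := (Submodule.span k (Set.range y)).map B.mkQ with hW
  have hWT : ∀ w ∈ W, T w ∈ W := by
    rintro _ ⟨z, hz, rfl⟩
    induction hz using Submodule.span_induction with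
    | mem z h =>
      obtain ⟨i, rfl⟩ := h
      obtain ⟨z, hz, h⟩ := hy i
      refine ⟨z, hz, ?_⟩
      rw [hTmk, eq_comm, ← sub_eq_zero, ← map_sub]
      exact (Submodule.Quotient.mk_eq_zero _).2 h
    | zero => simp
    | add a b _ _ ha hb => rw [map_add, map_add]; exact add_mem ha hb
    | smul c a _ ha => rw [map_smul, map_smul]; exact Submodule.smul_mem _ _ ha
  have : FiniteDimensional k (Submodule.span k (Set.range y)) :=
    FiniteDimensional.span_of_finite k (Set.finite_range y)
  have : FiniteDimensional k W := by rw [hW]; infer_instance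
  have hbot : Subsingleton W := by
    by_contra hne
    rw [not_subsingleton_iff_nontrivial] at hne
    -- An eigenvector in W would lift to z with D z − ω z in B, and the scalar case already puts z
    -- in B. No Jordan form is needed.
    obtain ⟨ω, hω⟩ := Module.End.exists_eigenvalue (T.restrict hWT)
    obtain ⟨⟨v, z, _, rfl⟩, h⟩ := hω.exists_hasEigenvector
    have h1 := congrArg Subtype.val h.apply_eq_smul
    change T (B.mkQ z) = ω • B.mkQ z at h1
    rw [hTmk, ← map_smul, ← sub_eq_zero, ← map_sub] at h1
    have h2 := mem_expPoly_of_deriv_sub_smul_mem hx hE hconst ω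
      ((Submodule.Quotient.mk_eq_zero _).1 h1)
    exact h.2 (Subtype.ext ((Submodule.Quotient.mk_eq_zero _).2 h2))
  have h1 : B.mkQ (y i) ∈ W := ⟨y i, Submodule.subset_span ⟨i, rfl⟩, rfl⟩
  have h2 := congrArg Subtype.val (Subsingleton.elim (⟨_, h1⟩ : W) 0)
  exact (Submodule.Quotient.mk_eq_zero _).1 h2

/-- Every exponential polynomial lies in a finite-dimensional subspace stable under `D`. -/
theorem exists_finiteDimensional_of_mem_expPoly (hx : D x = 1)
    (hE : ∀ ω, D (E (.ofAdd ω)) = ω • E (.ofAdd ω)) {y : F} (hy : y ∈ expPoly x E) :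
    ∃ N : Submodule k F, FiniteDimensional k N ∧ y ∈ N ∧ ∀ z ∈ N, D z ∈ N := by
  induction hy using expPoly_induction with
  | h0 => exact ⟨⊥, inferInstance, zero_mem _, by simp⟩
  | hadd a b _ _ ha hb =>
    obtain ⟨N, _, h1, h2⟩ := ha
    obtain ⟨N', _, h1', h2'⟩ := hb
    refine ⟨N ⊔ N', inferInstance, Submodule.add_mem_sup h1 h1', fun z hz => ?_⟩
    obtain ⟨u, hu, v, hv, rfl⟩ := Submodule.mem_sup.1 hz
    rw [map_add]
    exact Submodule.add_mem_sup (h2 u hu) (h2' v hv)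
  | hsmul c a _ ha =>
    obtain ⟨N, h, h1, h2⟩ := ha
    exact ⟨N, h, Submodule.smul_mem _ _ h1, h2⟩
  | hgen m ω =>
    refine ⟨Submodule.span k (Set.range fun i : Fin (m + 1) => x ^ (i : ℕ) * E (.ofAdd ω)),
      FiniteDimensional.span_of_finite k (Set.finite_range _),
      Submodule.subset_span ⟨Fin.last m, rfl⟩, fun z hz => ?_⟩
    induction hz using Submodule.span_induction with
    | mem z h =>
      obtain ⟨i, rfl⟩ := h
      change D (x ^ (i : ℕ) * E (.ofAdd ω)) ∈ _
      rw [deriv_pow_mul_exp hx hE]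
      exact add_mem (Submodule.smul_mem _ _ (Submodule.subset_span ⟨i, rfl⟩))
        (Submodule.smul_mem _ _ (Submodule.subset_span ⟨⟨i - 1, by omega⟩, rfl⟩))
    | zero => simp
    | add a b _ _ ha hb => rw [map_add]; exact add_mem ha hb
    | smul c a _ ha => rw [D.map_smul]; exact Submodule.smul_mem _ _ ha

end ExponentialPolynomials

/-! ## Taylor coefficients of a composition -/

section TaylorComposition

variable {T ι : Type*}

/-- The polynomial curve `ε ↦ a + ∑ εⁱ uᵢ / i!`, `1 ≤ i ≤ p`. -/
def taylorCurve (a : ι → ℂ) (u : ℕ → ι → ℂ) (p : ℕ) (ε : ℂ) : ι → ℂ :=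
  a + ∑ i ∈ Finset.Icc 1 p, (ε ^ i / (i.factorial : ℂ)) • u i

variable {a : ι → ℂ} {u : ℕ → ι → ℂ} {p : ℕ}

theorem taylorCurve_apply (ε : ℂ) (k : ι) :
    taylorCurve a u p ε k = a k + ∑ i ∈ Finset.Icc 1 p, ε ^ i / (i.factorial : ℂ) * u i k := by
  simp [taylorCurve]

theorem taylorCurve_zero : taylorCurve a u p 0 = a := by
  rw [taylorCurve, Finset.sum_eq_zero, add_zero]
  intro i hi
  rw [zero_pow (by simp at hi; omega), zero_div, zero_smul]

theorem analyticAt_taylorCurve_apply (k : ι) (z : ℂ) :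
    AnalyticAt ℂ (fun ε => taylorCurve a u p ε k) z := by
  simp only [taylorCurve_apply]
  fun_prop

theorem analyticAt_taylorCurve [Fintype ι] (z : ℂ) : AnalyticAt ℂ (taylorCurve a u p) z :=
  analyticAt_pi_iff.2 fun k => analyticAt_taylorCurve_apply k z

theorem iteratedDeriv_taylorCurve_apply {j : ℕ} (hj : 1 ≤ j) (k : ι) :
    iteratedDeriv j (fun ε => taylorCurve a u p ε k) 0 = if j ≤ p then u j k else 0 := by
  simp only [taylorCurve_apply]
  rw [iteratedDeriv_const_add hj, iteratedDeriv_fun_sum fun i _ => by fun_prop]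
  simp only [iteratedDeriv_mul_const_field, iteratedDeriv_div_const, iteratedDeriv_fun_pow_zero]
  by_cases h : j ≤ p
  · rw [if_pos h, Finset.sum_eq_single j]
    · simp [Nat.factorial_ne_zero]
    · intro i _ hij
      simp [hij.symm]
    · simp; omega
  · rw [if_neg h]
    refine Finset.sum_eq_zero fun i hi => ?_
    rw [Finset.mem_Icc] at hi
    rw [if_neg (by omega)]
    simp

variable [Fintype ι] [DecidableEq ι]

theorem AnalyticAt.fderiv_apply_single {F : (ι → ℂ) → ℂ} (hF : AnalyticAt ℂ F a) (k : ι) :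
    AnalyticAt ℂ (fun q => fderiv ℂ F q (Pi.single k 1)) a := by
  let L : ((ι → ℂ) →L[ℂ] ℂ) →L[ℂ] ℂ := ContinuousLinearMap.apply ℂ ℂ (Pi.single k (1 : ℂ))
  exact (L.analyticAt (fderiv ℂ F a)).comp (AnalyticAt.fderiv hF)

/-- Leibniz expansion of the Taylor coefficients of `F ∘ c`, from the chain rule. -/
theorem iteratedDeriv_succ_comp_taylorCurve {F : (ι → ℂ) → ℂ} (hF : AnalyticAt ℂ F a) (j : ℕ) :
    iteratedDeriv (j + 1) (fun ε => F (taylorCurve a u p ε)) 0 =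
      ∑ k, ∑ i ∈ Finset.range (j + 1), (j.choose i : ℂ) *
        iteratedDeriv i (fun ε => fderiv ℂ F (taylorCurve a u p ε) (Pi.single k 1)) 0 *
        (if j - i + 1 ≤ p then u (j - i + 1) k else 0) := by
  have hc0 : Tendsto (taylorCurve a u p) (𝓝 0) (𝓝 a) := by
    simpa [taylorCurve_zero] using
      (analyticAt_taylorCurve (a := a) (u := u) (p := p) 0).continuousAt.tendsto
  have hd : deriv (fun ε => F (taylorCurve a u p ε)) =ᶠ[𝓝 0] fun ε => ∑ k,
      fderiv ℂ F (taylorCurve a u p ε) (Pi.single k 1) *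
        deriv (fun ε => taylorCurve a u p ε k) ε := by
    filter_upwards [hc0.eventually hF.eventually_analyticAt] with ε hε
    have h1 : HasDerivAt (taylorCurve a u p)
        (fun k => deriv (fun ε => taylorCurve a u p ε k) ε) ε :=
      hasDerivAt_pi.2 fun k =>
        (analyticAt_taylorCurve_apply k ε).differentiableAt.hasDerivAt
    have h2 := (hε.differentiableAt.hasFDerivAt.comp_hasDerivAt ε h1).deriv
    rw [show (fun ε => F (taylorCurve a u p ε)) = F ∘ taylorCurve a u p from rfl, h2]
    refine ((fderiv ℂ F (taylorCurve a u p ε)).toLinearMap.pi_apply_eq_sum_univ _).trans ?_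
    refine Finset.sum_congr rfl fun k _ => ?_
    have hk : (fun l => if k = l then 1 else 0) = Pi.single k (1 : ℂ) := by
      ext l
      simp [Pi.single_apply, eq_comm]
    rw [smul_eq_mul, mul_comm, hk]
    rfl
  have hA : ∀ k, AnalyticAt ℂ
      (fun ε => fderiv ℂ F (taylorCurve a u p ε) (Pi.single k 1)) 0 := by
    intro k
    have h : AnalyticAt ℂ (fun q => fderiv ℂ F q (Pi.single k 1)) (taylorCurve a u p 0) := by
      rw [taylorCurve_zero]
      exact hF.fderiv_apply_single k
    exact h.comp (analyticAt_taylorCurve 0)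
  rw [iteratedDeriv_succ', hd.iteratedDeriv_eq, iteratedDeriv_fun_sum fun k _ =>
    ((hA k).fun_mul (analyticAt_taylorCurve_apply (a := a) (u := u) (p := p) k 0).deriv).contDiffAt]
  refine Finset.sum_congr rfl fun k _ => ?_
  rw [iteratedDeriv_fun_mul (hA k).contDiffAt
    (analyticAt_taylorCurve_apply k 0).deriv.contDiffAt]
  refine Finset.sum_congr rfl fun i _ => ?_
  rw [← iteratedDeriv_succ', iteratedDeriv_taylorCurve_apply (by omega)]

theorem Subalgebra.fun_mul_mem {A : Subalgebra ℂ (T → ℂ)} {f g : T → ℂ} (hf : f ∈ A)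
    (hg : g ∈ A) : (fun t => f t * g t) ∈ A := mul_mem hf hg

theorem Subalgebra.fun_sum_mem {A : Subalgebra ℂ (T → ℂ)} {κ : Type*} {s : Finset κ}
    {f : κ → T → ℂ} (hf : ∀ i ∈ s, f i ∈ A) : (fun t => ∑ i ∈ s, f i t) ∈ A := by
  rw [← Finset.sum_fn]
  exact sum_mem hf

/-- The Taylor coefficients of `F ∘ c` of order at most `j` are polynomials in `u₁, …, u_j`. -/
theorem iteratedDeriv_comp_taylorCurve_mem (A : Subalgebra ℂ (T → ℂ)) (u : ℕ → T → ι → ℂ) (p : ℕ)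
    {F : (ι → ℂ) → ℂ} (hF : AnalyticAt ℂ F a) (j : ℕ)
    (hu : ∀ i ∈ Finset.Icc 1 p, i ≤ j → ∀ k, (fun t => u i t k) ∈ A) :
    (fun t => iteratedDeriv j (fun ε => F (taylorCurve a (fun i => u i t) p ε)) 0) ∈ A := by
  induction j using Nat.strong_induction_on generalizing F with
  | _ j ih =>
    rcases j with _ | j
    · simp only [iteratedDeriv_zero, taylorCurve_zero]
      exact A.algebraMap_mem (F a)
    · simp only [iteratedDeriv_succ_comp_taylorCurve hF]
      refine Subalgebra.fun_sum_mem fun k _ => Subalgebra.fun_sum_mem fun i hi => ?_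
      rw [Finset.mem_range] at hi
      refine Subalgebra.fun_mul_mem (Subalgebra.fun_mul_mem (A.algebraMap_mem _) ?_) ?_
      -- The chain rule trades one order of differentiation for a partial derivative of F, so
      -- induction over all F at once replaces Faà di Bruno's formula.
      · exact ih i hi (hF.fderiv_apply_single k) fun l hl hli => hu l hl (by omega)
      · split_ifs with h
        · exact hu _ (by simp; omega) (by omega) k
        · exact zero_mem A

/-- In the Taylor coefficient of `F ∘ c` of order `j`, the vector `u_j` occurs only linearly. -/
theorem iteratedDeriv_comp_taylorCurve_sub_mem (A : Subalgebra ℂ (T → ℂ)) (u : ℕ → T → ι → ℂ)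
    {p : ℕ} {F : (ι → ℂ) → ℂ} (hF : AnalyticAt ℂ F a) {j : ℕ} (hj : j ∈ Finset.Icc 1 p)
    (hu : ∀ i ∈ Finset.Icc 1 p, i < j → ∀ k, (fun t => u i t k) ∈ A) :
    (fun t => iteratedDeriv j (fun ε => F (taylorCurve a (fun i => u i t) p ε)) 0 -
      ∑ k, fderiv ℂ F a (Pi.single k 1) * u j t k) ∈ A := by
  rw [Finset.mem_Icc] at hj
  obtain ⟨j, rfl⟩ := Nat.exists_eq_add_of_le' hj.1
  simp only [iteratedDeriv_succ_comp_taylorCurve hF, ← Finset.sum_sub_distrib]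
  refine Subalgebra.fun_sum_mem fun k _ => ?_
  -- Only the i = 0 term of the Leibniz sum contains the top vector, and it is exactly the
  -- subtracted linear term.
  simp only [Finset.sum_range_succ', Nat.sub_zero, if_pos hj.2, Nat.choose_zero_right,
    Nat.cast_one, one_mul, iteratedDeriv_zero, taylorCurve_zero, add_sub_cancel_right]
  refine Subalgebra.fun_sum_mem fun i hi => ?_
  rw [Finset.mem_range] at hi
  refine Subalgebra.fun_mul_mem (Subalgebra.fun_mul_mem (A.algebraMap_mem _) ?_) ?_
  · exact iteratedDeriv_comp_taylorCurve_mem A u p (hF.fderiv_apply_single k) (i + 1)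
      fun l hl hli => hu l hl (by omega)
  · split_ifs with h
    · exact hu _ (by simp; omega) (by omega) k
    · exact zero_mem A

end TaylorComposition

/-! ## Endomorphisms commuting with a derivation -/

section CommutingEndomorphisms

variable {k L : Type*} [Field k] [Field L] [Algebra k L] {T : Derivation k L L}

theorem iterate_deriv_pow {x : L} (hx : T x = 1) (n : ℕ) :
    ((T : L →ₗ[k] L) ^ n) (x ^ n) = algebraMap k L (n.factorial : k) := by
  induction n with
  | zero => simp
  | succ n ih =>
    have h : (T : L →ₗ[k] L) (x ^ (n + 1)) = ((n + 1 : ℕ) : k) • x ^ n := by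
      change T _ = _
      rw [Derivation.leibniz_pow, hx, Nat.add_sub_cancel, smul_eq_mul, mul_one, Nat.cast_smul_eq_nsmul]
    rw [pow_succ, Module.End.mul_apply, h, map_smul, ih, Algebra.smul_def, ← map_mul,
      Nat.factorial_succ, Nat.cast_mul]

/-- If `x' = 1`, the elements with a vanishing iterated derivative are polynomials in `x`. -/
theorem mem_of_iterate_deriv_eq_zero [CharZero k]
    (hconst : ∀ y, T y = 0 → ∃ c, algebraMap k L c = y) {x : L} (hx : T x = 1)
    {C : Subalgebra k L} (hxC : x ∈ C) (n : ℕ) {y : L} (hy : ((T : L →ₗ[k] L) ^ n) y = 0) :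
    y ∈ C := by
  induction n generalizing y with
  | zero =>
    rw [pow_zero, Module.End.one_apply] at hy
    exact hy ▸ zero_mem C
  | succ n ih =>
    rw [pow_succ', Module.End.mul_apply] at hy
    obtain ⟨c, hc⟩ := hconst _ hy
    have hn : (n.factorial : k) ≠ 0 := by exact_mod_cast n.factorial_ne_zero
    -- The n-th derivative of y is the constant c, and that of x^n is n!.
    have h := ih (y := y - (c / n.factorial) • x ^ n) (by
      rw [map_sub, map_smul, iterate_deriv_pow hx, Algebra.smul_def, ← map_mul,
        div_mul_cancel₀ _ hn, hc, sub_self])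
    simpa using add_mem h (C.smul_mem (pow_mem hxC n) (c / n.factorial))

variable {σ τ : L →ₐ[k] L}

/-- σ h and h have the same logarithmic derivative ω, so their quotient is a constant. -/
theorem exists_apply_eq_smul (hconst : ∀ y, T y = 0 → ∃ c, algebraMap k L c = y)
    (hσ : ∀ x, σ (T x) = T (σ x)) {h : L} {ω : k} (hh : h ≠ 0) (hT : T h = ω • h) :
    ∃ c : k, σ h = c • h := by
  obtain ⟨c, hc⟩ := hconst (σ h / h) (by
    rw [Derivation.leibniz_div, ← hσ, hT, map_smul]
    simp only [smul_eq_mul, Algebra.smul_def]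
    ring)
  exact ⟨c, by rw [Algebra.smul_def, hc, div_mul_cancel₀ _ hh]⟩

/-- σ x and x have the same derivative 1. -/
theorem exists_apply_eq_add (hconst : ∀ y, T y = 0 → ∃ c, algebraMap k L c = y)
    (hσ : ∀ x, σ (T x) = T (σ x)) {x : L} (hx : T x = 1) :
    ∃ c : k, σ x = x + algebraMap k L c := by
  obtain ⟨c, hc⟩ := hconst (σ x - x) (by rw [map_sub, ← hσ, hx, map_one, sub_self])
  exact ⟨c, by rw [hc, add_sub_cancel]⟩

/-- Two endomorphisms that commute with the derivation commute with each other on the elements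
that lie in finite-dimensional subspaces stable under the derivation. -/
theorem commute_apply_of_mem_finiteDimensional [CharZero k] [IsAlgClosed k]
    (hconst : ∀ y, T y = 0 → ∃ c, algebraMap k L c = y)
    (hσ : ∀ x, σ (T x) = T (σ x)) (hτ : ∀ x, τ (T x) = T (τ x))
    (N : Submodule k L) [FiniteDimensional k N] (hN : ∀ z ∈ N, T z ∈ N) {y : L} (hy : y ∈ N) :
    σ (τ y) = τ (σ y) := by
  set C : Subalgebra k L := AlgHom.equalizer (σ.comp τ) (τ.comp σ)
  have memC : ∀ z, z ∈ C ↔ σ (τ z) = τ (σ z) := fun z => Iff.rfl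
  have hCeig : ∀ (h : L) (ω : k), h ≠ 0 → T h = ω • h → h ∈ C := by
    intro h ω hh hT
    obtain ⟨a, ha⟩ := exists_apply_eq_smul hconst hσ hh hT
    obtain ⟨b, hb⟩ := exists_apply_eq_smul hconst hτ hh hT
    rw [memC, hb, ha, map_smul, map_smul, hb, ha, smul_comm]
  have hCone : ∀ x, T x = 1 → x ∈ C := by
    intro x hx
    obtain ⟨a, ha⟩ := exists_apply_eq_add hconst hσ hx
    obtain ⟨b, hb⟩ := exists_apply_eq_add hconst hτ hx
    rw [memC, hb, ha, map_add, map_add, hb, ha, AlgHom.commutes, AlgHom.commutes]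
    ring
  have hgen : ∀ (ω : k) (n : ℕ) (z : L),
      (((T : L →ₗ[k] L) - ω • (1 : Module.End k L)) ^ n) z = 0 → z ∈ C := by
    intro ω n z hz
    set A : Module.End k L := (T : L →ₗ[k] L) - ω • (1 : Module.End k L)
    have hAapp : ∀ w, A w = T w - ω • w := fun w => rfl
    induction n with
    | zero =>
      rw [pow_zero, Module.End.one_apply] at hz
      exact hz ▸ zero_mem C
    | succ n ih =>
      by_cases hn : (A ^ n) z = 0
      · exact ih hn
      -- The last nonzero vector of the chain is an eigenvector h.
      set h := (A ^ n) z with hh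
      have hTh : T h = ω • h := by
        rw [pow_succ', Module.End.mul_apply, hAapp, sub_eq_zero] at hz
        exact hz
      have hhC := hCeig h ω hn hTh
      -- Conjugation by h turns T − ω into T, so z/h behaves like a polynomial of degree n.
      have hAmul : ∀ w, A (h * w) = h * T w := by
        intro w
        rw [hAapp, Derivation.leibniz, hTh]
        simp only [smul_eq_mul, Algebra.smul_def]
        ring
      have hApow : ∀ (m : ℕ) (w : L), (A ^ m) (h * w) = h * ((T : L →ₗ[k] L) ^ m) w := by
        intro m w
        induction m with
        | zero => simp
        | succ m ihm =>
          rw [pow_succ', pow_succ', Module.End.mul_apply, Module.End.mul_apply, ihm, hAmul]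
          rfl
      have hzh : h * (z / h) = z := mul_div_cancel₀ _ hn
      have hTz : ((T : L →ₗ[k] L) ^ (n + 1)) (z / h) = 0 := by
        have := hApow (n + 1) (z / h)
        rw [hzh, hz, eq_comm, mul_eq_zero] at this
        exact this.resolve_left hn
      have hTn : ((T : L →ₗ[k] L) ^ n) (z / h) = 1 := by
        have := hApow n (z / h)
        rw [hzh, ← hh] at this
        exact (mul_eq_left₀ hn).1 this.symm
      rw [← hzh]
      refine mul_mem hhC ?_
      -- For n = 0, z/h = 1. Otherwise the next-to-last derivative of z/h is an x with T x = 1 and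
      -- z/h is a polynomial in it; thus x and h are found inside L itself, although I and the
      -- exponentials need not lie there.
      rcases n with _ | n
      · rw [pow_zero, Module.End.one_apply] at hTn
        rw [hTn]
        exact one_mem C
      · refine mem_of_iterate_deriv_eq_zero hconst (x := ((T : L →ₗ[k] L) ^ n) (z / h)) ?_
          (hCone _ ?_) _ hTz <;>
        · rw [pow_succ', Module.End.mul_apply] at hTn
          exact hTn
  let TN : Module.End k N := (T : L →ₗ[k] L).restrict hN
  have hpow : ∀ (ω : k) (n : ℕ) (z : N), (((TN - ω • (1 : Module.End k N)) ^ n) z : L) =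
      (((T : L →ₗ[k] L) - ω • (1 : Module.End k L)) ^ n) z := by
    intro ω n z
    induction n with
    | zero => rfl
    | succ n ih =>
      rw [pow_succ', pow_succ', Module.End.mul_apply, Module.End.mul_apply, ← ih]
      rfl
  have htop : (⟨y, hy⟩ : N) ∈ ⨆ ω, TN.maxGenEigenspace ω := by
    rw [Module.End.iSup_maxGenEigenspace_eq_top]
    exact Submodule.mem_top
  refine (memC y).1 (Submodule.iSup_induction _ (motive := fun z : N => (z : L) ∈ C) htop ?_
    (zero_mem C) fun a b ha hb => add_mem ha hb)
  intro ω z hz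
  obtain ⟨n, hn⟩ := (Module.End.mem_maxGenEigenspace _ _ _).1 hz
  exact hgen ω n z (by rw [← hpow, hn]; rfl)

end CommutingEndomorphisms

/-! ### Commutativity of the differential Galois group. -/

section AbelianDifferentialGaloisGroup

variable {k M : Type*} [Field k] [Field M] [Differential M] [Algebra k M]

/-- A sufficient condition for a differential Galois group to be Abelian: up to factors in the
ground field and up to differentiation, the generators of the extension lie in finite-dimensional
spaces stable under the derivation `r d/dt`, where `r` is in the ground field. -/
theorem diffGaloisGroup_commute [CharZero k] [IsAlgClosed k] (K : IntermediateField k M)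
    {D : Derivation k M M} {r : M} (hrK : r ∈ K) (hD : ∀ x, D x = r * x′)
    (hconst : ∀ y, D y = 0 → ∃ c, algebraMap k M c = y) {S : Set M}
    (hS : ∀ s ∈ S, ∃ y ∈ diffAdjoin K S, (∃ N : Submodule k M, FiniteDimensional k N ∧ y ∈ N ∧
      ∀ z ∈ N, D z ∈ N) ∧ ∃ a ∈ K, s = a * y ∨ s = (a * y)′)
    {σ τ : diffAdjoin K S ≃ₐ[K] diffAdjoin K S} (hσ : σ ∈ diffGaloisGroup K (diffAdjoin K S))
    (hτ : τ ∈ diffGaloisGroup K (diffAdjoin K S)) : σ * τ = τ * σ := by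
  have hDL : ∀ x ∈ diffAdjoin K S, D x ∈ (diffAdjoin K S) := by
    intro x hx
    rw [hD]
    exact mul_mem ((diffAdjoin K S).algebraMap_mem ⟨r, hrK⟩) (deriv_mem_diffAdjoin K S hx)
  let DL : diffAdjoin K S →ₗ[k] (diffAdjoin K S) :=
    { toFun := fun x => ⟨D x, hDL x x.2⟩
      map_add' := fun x y => Subtype.ext (D.map_add x y)
      map_smul' := fun c x => Subtype.ext (D.map_smul c (x : M)) }
  let T : Derivation k (diffAdjoin K S) (diffAdjoin K S) := Derivation.mk' DL fun x y => Subtype.ext (D.leibniz (x : M) y)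
  have hTr : ∀ x : diffAdjoin K S, T x = algebraMap K (diffAdjoin K S) ⟨r, hrK⟩ * x′ := fun x => Subtype.ext (hD x)
  have hTconst : ∀ y, T y = 0 → ∃ c, algebraMap k (diffAdjoin K S) c = y := by
    intro y hy
    obtain ⟨c, hc⟩ := hconst y (congrArg Subtype.val hy)
    exact ⟨c, Subtype.ext hc⟩
  have hcomm : ∀ ρ ∈ diffGaloisGroup K (diffAdjoin K S), ∀ x, ρ (T x) = T (ρ x) := by
    intro ρ hρ x
    rw [hTr, hTr, map_mul, ρ.commutes, hρ]
  -- The locus where σ and τ commute is a differential subfield, so by minimality of `diffAdjoin` it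
  -- suffices that it contains the generators.
  let E₀ : IntermediateField K (diffAdjoin K S) :=
    { AlgHom.equalizer (σ.toAlgHom.comp τ.toAlgHom) (τ.toAlgHom.comp σ.toAlgHom) with
      inv_mem' := fun x hx => by
        change σ (τ x⁻¹) = τ (σ x⁻¹)
        have hx' : σ (τ x) = τ (σ x) := hx
        rw [map_inv₀, map_inv₀, map_inv₀, map_inv₀, hx'] }
  have memE : ∀ x, x ∈ E₀ ↔ σ (τ x) = τ (σ x) := fun x => Iff.rfl
  have hEderiv : ∀ x ∈ E₀, x′ ∈ E₀ := by
    intro x hx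
    rw [memE] at hx ⊢
    rw [hτ, hσ, hσ, hτ, hx]
  have hfin : ∀ (y : diffAdjoin K S) (N : Submodule k M), FiniteDimensional k N → (y : M) ∈ N →
      (∀ z ∈ N, D z ∈ N) → y ∈ E₀ := by
    intro y N hNfin hyN hN
    -- N may leave the extension; its intersection with the extension is still D-stable and
    -- finite-dimensional.
    let N' : Submodule k (diffAdjoin K S) := N.comap (((diffAdjoin K S).val.restrictScalars k).toLinearMap)
    have : FiniteDimensional k N' :=
      Module.Finite.of_injective
        ((((diffAdjoin K S).val.restrictScalars k).toLinearMap).restrict (p := N') (q := N) fun z hz => hz)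
        fun a b hab => Subtype.ext (Subtype.ext (congrArg (fun z : N => (z : M)) hab))
    exact commute_apply_of_mem_finiteDimensional (T := T)
      (σ := (σ.toAlgHom.restrictScalars k)) (τ := (τ.toAlgHom.restrictScalars k)) hTconst
      (hcomm σ hσ) (hcomm τ hτ) N' (fun z hz => hN z hz) hyN
  have hle : diffAdjoin K S ≤ E₀.map (diffAdjoin K S).val := by
    refine sInf_le ⟨fun s hs => ?_, ?_⟩
    · obtain ⟨y, hyL, ⟨N, hNfin, hyN, hN⟩, a, ha, h⟩ := hS s hs
      have hay : algebraMap K (diffAdjoin K S) ⟨a, ha⟩ * ⟨y, hyL⟩ ∈ E₀ :=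
        mul_mem (E₀.algebraMap_mem _) (hfin _ N hNfin hyN hN)
      rcases h with rfl | rfl
      · exact ⟨_, hay, rfl⟩
      · exact ⟨_, hEderiv _ hay, rfl⟩
    · rintro _ ⟨x, hx, rfl⟩
      exact ⟨x′, hEderiv x hx, rfl⟩
  ext x : 1
  obtain ⟨z, hz, hzx⟩ := hle x.2
  have : z = x := Subtype.ext hzx
  exact (memE x).1 (this ▸ hz)

end AbelianDifferentialGaloisGroup

/-! ## Germs of meromorphic functions -/

namespace Mero

variable {z : ℂ}

/-- The germ of a meromorphic function. -/
def of (f : ℂ → ℂ) (hf : MeromorphicAt f z) : Mero z := ⟨(f : Germ (𝓝[≠] z) ℂ), f, hf, rfl⟩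

theorem of_eq_of {f g : ℂ → ℂ} {hf : MeromorphicAt f z} {hg : MeromorphicAt g z} :
    of f hf = of g hg ↔ f =ᶠ[𝓝[≠] z] g :=
  Subtype.ext_iff.trans Germ.coe_eq

theorem exists_of (x : Mero z) : ∃ (f : ℂ → ℂ) (hf : MeromorphicAt f z), x = of f hf := by
  obtain ⟨f, hf, h⟩ := x.exists_rep
  exact ⟨f, hf, Subtype.ext h⟩

theorem of_congr {f g : ℂ → ℂ} {hf : MeromorphicAt f z} {hg : MeromorphicAt g z}
    (h : f =ᶠ[𝓝 z] g) : of f hf = of g hg :=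
  of_eq_of.2 (h.filter_mono nhdsWithin_le_nhds)

theorem deriv_of {f : ℂ → ℂ} (hf : MeromorphicAt f z) : (of f hf)′ = of (deriv f) hf.deriv := rfl

theorem mul_of {f g : ℂ → ℂ} (hf : MeromorphicAt f z) (hg : MeromorphicAt g z) :
    of f hf * of g hg = of (fun t => f t * g t) (hf.mul hg) := rfl

theorem add_of {f g : ℂ → ℂ} (hf : MeromorphicAt f z) (hg : MeromorphicAt g z) :
    of f hf + of g hg = of (fun t => f t + g t) (hf.add hg) := rfl

theorem smul_of (c : ℂ) {f : ℂ → ℂ} (hf : MeromorphicAt f z) :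
    c • of f hf = of (fun t => c * f t) ((MeromorphicAt.const c z).mul hf) := rfl

theorem algebraMap_eq_of (c : ℂ) :
    algebraMap ℂ (Mero z) c = of (fun _ => c) (MeromorphicAt.const c z) := rfl

theorem one_eq_of : (1 : Mero z) = of (fun _ => 1) (MeromorphicAt.const 1 z) := rfl

theorem zero_eq_of : (0 : Mero z) = of (fun _ => 0) (MeromorphicAt.const 0 z) := rfl

theorem pow_of {f : ℂ → ℂ} (hf : MeromorphicAt f z) (m : ℕ) :
    of f hf ^ m = of (fun t => f t ^ m) (hf.pow m) := by
  induction m with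
  | zero => simp [one_eq_of]
  | succ m ih => simp only [pow_succ, ih, mul_of]

theorem deriv_algebraMap (c : ℂ) : (algebraMap ℂ (Mero z) c)′ = 0 := by
  rw [algebraMap_eq_of, deriv_of, zero_eq_of, of_eq_of]
  simp

/-- The constants of the field of meromorphic germs are the complex numbers. -/
theorem exists_algebraMap_eq_of_deriv_eq_zero (x : Mero z) (hx : x′ = 0) :
    ∃ c, algebraMap ℂ (Mero z) c = x := by
  obtain ⟨f, hf, rfl⟩ := x.exists_of
  rw [deriv_of, zero_eq_of, of_eq_of] at hx
  obtain ⟨ε, hε, h⟩ := Metric.eventually_nhds_iff_ball.1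
    (eventually_nhdsWithin_iff.1 (hx.and hf.eventually_analyticAt))
  have hmero : MeromorphicOn f (Metric.ball z ε) := by
    intro t ht
    by_cases htz : t = z
    · rwa [htz]
    · exact (h t ht htz).2.meromorphicAt
  obtain ⟨t₁, ht₁, ht₁z⟩ : ∃ t ∈ Metric.ball z ε, t ≠ z := by
    have hne : (𝓝[≠] z).NeBot := inferInstance
    have hball : ∀ᶠ t in 𝓝[≠] z, t ∈ Metric.ball z ε :=
      nhdsWithin_le_nhds (Metric.ball_mem_nhds z hε)
    exact (hball.and eventually_mem_nhdsWithin).exists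
  set c := f t₁
  refine ⟨c, ?_⟩
  rw [algebraMap_eq_of, of_eq_of]
  have hg : MeromorphicOn (fun t => f t - c) (Metric.ball z ε) := fun t ht =>
    (hmero t ht).sub (MeromorphicAt.const c t)
  -- The derivative is controlled only off z. Near t₁ ≠ z the function is constant, and the identity
  -- theorem for meromorphic functions carries this across the ball to z.
  have h1 : meromorphicOrderAt (fun t => f t - c) t₁ = ⊤ := by
    have hopen : IsOpen (Metric.ball z ε \ {z}) := Metric.isOpen_ball.sdiff isClosed_singleton
    obtain ⟨δ, hδ, hsub⟩ := Metric.isOpen_iff.1 hopen t₁ ⟨ht₁, ht₁z⟩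
    obtain ⟨b, hb⟩ := Metric.isOpen_ball.exists_is_const_of_deriv_eq_zero
      (convex_ball t₁ δ).isPreconnected
      (fun t ht => (h t (hsub ht).1 (hsub ht).2).2.differentiableAt.differentiableWithinAt)
      (fun t ht => (h t (hsub ht).1 (hsub ht).2).1)
    rw [meromorphicOrderAt_eq_top_iff]
    filter_upwards [nhdsWithin_le_nhds (Metric.ball_mem_nhds t₁ hδ)] with t ht
    rw [hb t ht, ← hb t₁ (Metric.mem_ball_self hδ), sub_self]
  have h2 : meromorphicOrderAt (fun t => f t - c) z = ⊤ := by
    by_contra hne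
    exact hg.meromorphicOrderAt_ne_top_of_isPreconnected (convex_ball z ε).isPreconnected
      (Metric.mem_ball_self hε) ht₁ hne h1
  rw [meromorphicOrderAt_eq_top_iff] at h2
  filter_upwards [h2] with t ht
  exact (sub_eq_zero.1 ht).symm

/-- The derivation `r d/dt`. -/
def scaledDeriv (r : Mero z) : Derivation ℂ (Mero z) (Mero z) :=
  Derivation.mk'
    { toFun := fun x => (r * x′)
      map_add' := by
        intro x y
        rw [map_add, mul_add]
      map_smul' := by
        intro c x
        rw [Algebra.smul_def, Derivation.leibniz, deriv_algebraMap, smul_zero, add_zero,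
          smul_eq_mul, RingHom.id_apply, Algebra.smul_def]
        ring }
    fun x y => by
      change r * (x * y)′ = x • (r * y′) + y • (r * x′)
      rw [Derivation.leibniz]
      simp only [smul_eq_mul]
      ring

theorem scaledDeriv_apply (r x : Mero z) : scaledDeriv r x = r * x′ := rfl

theorem exists_algebraMap_eq_of_scaledDeriv_eq_zero {r : Mero z} (hr : r ≠ 0) (x : Mero z)
    (hx : scaledDeriv r x = 0) : ∃ c, algebraMap ℂ (Mero z) c = x :=
  exists_algebraMap_eq_of_deriv_eq_zero x ((mul_eq_zero.1 hx).resolve_left hr)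

theorem scaledDeriv_of {r f g : ℂ → ℂ} {hr : MeromorphicAt r z} {hf : MeromorphicAt f z}
    {hg : MeromorphicAt g z} (h : ∀ᶠ t in 𝓝 z, r t * deriv f t = g t) :
    scaledDeriv (of r hr) (of f hf) = of g hg := by
  rw [scaledDeriv_apply, deriv_of, mul_of]
  exact of_congr h

/-- The germs of the functions `exp (ω f)`. -/
def expHom (f : ℂ → ℂ) (hf : AnalyticAt ℂ f z) : Multiplicative ℂ →* Mero z where
  toFun ω := of (fun t => Complex.exp (ω.toAdd * f t))
    (by fun_prop : AnalyticAt ℂ (fun t => Complex.exp (ω.toAdd * f t)) z).meromorphicAt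
  map_one' := by
    rw [one_eq_of, of_eq_of]
    simp
  map_mul' a b := by
    rw [mul_of, of_eq_of]
    refine Eventually.of_forall fun t => ?_
    simp only [toAdd_mul, add_mul, Complex.exp_add]

theorem expHom_ofAdd (f : ℂ → ℂ) (hf : AnalyticAt ℂ f z) (ω : ℂ) :
    expHom f hf (.ofAdd ω) = of (fun t => Complex.exp (ω * f t))
      (by fun_prop : AnalyticAt ℂ (fun t => Complex.exp (ω * f t)) z).meromorphicAt := rfl

variable {r f : ℂ → ℂ} {hr : MeromorphicAt r z}

theorem scaledDeriv_of_eq_one (hf : AnalyticAt ℂ f z) (h : ∀ᶠ t in 𝓝 z, r t * deriv f t = 1) :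
    scaledDeriv (of r hr) (of f hf.meromorphicAt) = 1 :=
  scaledDeriv_of (hg := MeromorphicAt.const 1 z) h

theorem scaledDeriv_expHom (hf : AnalyticAt ℂ f z) (h : ∀ᶠ t in 𝓝 z, r t * deriv f t = 1)
    (ω : ℂ) : scaledDeriv (of r hr) (expHom f hf (.ofAdd ω)) = ω • expHom f hf (.ofAdd ω) := by
  rw [expHom_ofAdd, smul_of]
  refine scaledDeriv_of ?_
  filter_upwards [h, hf.eventually_analyticAt] with t ht hft
  rw [((hft.differentiableAt.hasDerivAt.const_mul ω).cexp).deriv]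
  linear_combination ω * Complex.exp (ω * f t) * ht

/-- The exponential polynomials in the germ of `f` are the germs of the elements of
`logExpSpan f`. -/
theorem exists_logExpSpan_of_mem_expPoly (hf : AnalyticAt ℂ f z) {x : Mero z}
    (hx : x ∈ expPoly (of f hf.meromorphicAt) (expHom f hf)) :
    ∃ b ∈ logExpSpan f, ∃ hb : AnalyticAt ℂ b z, x = of b hb.meromorphicAt := by
  induction hx using expPoly_induction with
  | h0 => exact ⟨0, zero_mem _, analyticAt_const, rfl⟩
  | hadd a b _ _ ha hb =>
    obtain ⟨a', ha', haz, rfl⟩ := ha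
    obtain ⟨b', hb', hbz, rfl⟩ := hb
    exact ⟨a' + b', add_mem ha' hb', haz.add hbz, rfl⟩
  | hsmul c a _ ha =>
    obtain ⟨a', ha', haz, rfl⟩ := ha
    exact ⟨c • a', Submodule.smul_mem _ _ ha', haz.const_smul, rfl⟩
  | hgen m ω =>
    refine ⟨_, Submodule.subset_span ⟨m, ω, rfl⟩, by fun_prop, ?_⟩
    rw [pow_of, expHom_ofAdd, mul_of]

/-- The functions meromorphic at `z` with germ in a given subalgebra. -/
def preimageSubalgebra (B : Subalgebra ℂ (Mero z)) : Subalgebra ℂ (ℂ → ℂ) where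
  carrier := {f | ∃ hf : MeromorphicAt f z, of f hf ∈ B}
  mul_mem' := by
    rintro f g ⟨hf, hfB⟩ ⟨hg, hgB⟩
    exact ⟨hf.mul hg, mul_mem hfB hgB⟩
  add_mem' := by
    rintro f g ⟨hf, hfB⟩ ⟨hg, hgB⟩
    exact ⟨hf.add hg, add_mem hfB hgB⟩
  algebraMap_mem' c := ⟨MeromorphicAt.const c z, B.algebraMap_mem c⟩

end Mero

namespace Mero

theorem sum_of {z : ℂ} {κ : Type*} (s : Finset κ) {f : κ → ℂ → ℂ}
    (hf : ∀ i, MeromorphicAt (f i) z) :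
    ∃ h : MeromorphicAt (fun t => ∑ i ∈ s, f i t) z, of _ h = ∑ i ∈ s, of (f i) (hf i) := by
  classical
  induction s using Finset.induction_on with
  | empty => exact ⟨MeromorphicAt.const 0 z, by simp [zero_eq_of]⟩
  | insert a s ha ih =>
    obtain ⟨h, e⟩ := ih
    simp only [Finset.sum_insert ha]
    exact ⟨(hf a).add h, by rw [← e, add_of]⟩

end Mero

/-! ## The variational equations in the coordinates `u = q / φ` -/

theorem iteratedDeriv_apply {ι : Type*} [Fintype ι] {f : ℂ → ι → ℂ} {a : ℂ} {j : ℕ}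
    (hf : ContDiffAt ℂ j f a) (i : ι) :
    iteratedDeriv j f a i = iteratedDeriv j (fun ε => f ε i) a := by
  have h := (ContinuousLinearMap.proj (R := ℂ) (φ := fun _ : ι => ℂ) i).iteratedFDeriv_comp_left
    hf le_rfl
  have h' := congrArg (fun m => m fun _ => (1 : ℂ)) h
  exact h'.symm

section Homogeneous

variable {n : ℕ} {U : Set (Fin n → ℂ)} {V : (Fin n → ℂ) → ℂ}

theorem analyticAt_gradV {q : Fin n → ℂ} (hV : AnalyticAt ℂ V q) (k : Fin n) :
    AnalyticAt ℂ (fun q => gradV V q k) q :=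
  hV.fderiv_apply_single k

/-- The gradient of a function homogeneous of degree `-2` is homogeneous of degree `-3`. -/
theorem gradV_smul (hU : IsOpen U) (hV : AnalyticOnNhd ℂ V U)
    (hhom : ∀ s : ℂ, s ≠ 0 → ∀ q ∈ U, s • q ∈ U ∧ V (s • q) = s ^ (-2 : ℤ) * V q)
    {s : ℂ} (hs : s ≠ 0) {q : Fin n → ℂ} (hq : q ∈ U) (k : Fin n) :
    gradV V (s • q) k = (s ^ 3)⁻¹ * gradV V q k := by
  -- The derivative of q ↦ V(sq) is computed twice, by the chain rule and by homogeneity.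
  have h1 : HasFDerivAt (fun q => V (s • q))
      ((fderiv ℂ V (s • q)).comp (s • ContinuousLinearMap.id ℂ (Fin n → ℂ))) q :=
    (hV _ (hhom s hs q hq).1).differentiableAt.hasFDerivAt.comp q ((hasFDerivAt_id q).const_smul s)
  have h2 : HasFDerivAt (fun q => V (s • q)) (s ^ (-2 : ℤ) • fderiv ℂ V q) q := by
    refine ((hV q hq).differentiableAt.hasFDerivAt.const_smul (s ^ (-2 : ℤ))).congr_of_eventuallyEq ?_
    filter_upwards [hU.mem_nhds hq] with q' hq'
    exact (hhom s hs q' hq').2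
  have h3 := congrArg (fun L => L (Pi.single k 1)) (h1.unique h2)
  simp only [ContinuousLinearMap.comp_apply, _root_.smul_apply, map_smul,
    ContinuousLinearMap.id_apply, smul_eq_mul] at h3
  have hz : s ^ (-2 : ℤ) = (s ^ 2)⁻¹ := by
    rw [zpow_neg]
    norm_cast
  rw [hz] at h3
  simp only [gradV]
  field_simp at h3 ⊢
  linear_combination h3

variable {d : Fin n → ℂ}

/-- The Taylor coefficients of Hamilton's vector field along a curve through `(f d, g d)`. -/
theorem iteratedDeriv_hamiltonField (hU : IsOpen U) (hV : AnalyticOnNhd ℂ V U)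
    (hhom : ∀ s : ℂ, s ≠ 0 → ∀ q ∈ U, s • q ∈ U ∧ V (s • q) = s ^ (-2 : ℤ) * V q)
    (hdU : d ∈ U) {φ ψ : ℂ → ℂ} {t : ℂ} (ht : φ t ≠ 0) {p j : ℕ} (hj : j ∈ Finset.Icc 1 p)
    (x : ℕ → Fin n ⊕ Fin n → ℂ) (k : Fin n) :
    iteratedDeriv j (fun ε : ℂ => hamiltonField V (darbouxCurve d φ ψ t +
        ∑ i ∈ Finset.Icc 1 p, (ε ^ i / (i.factorial : ℂ)) • x i)) 0 (Sum.inl k) =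
      x j (Sum.inr k) ∧
    iteratedDeriv j (fun ε : ℂ => hamiltonField V (darbouxCurve d φ ψ t +
        ∑ i ∈ Finset.Icc 1 p, (ε ^ i / (i.factorial : ℂ)) • x i)) 0 (Sum.inr k) =
      -((φ t ^ 3)⁻¹ * iteratedDeriv j (fun ε => gradV V
        (taylorCurve d (fun i k => x i (Sum.inl k) / φ t) p ε) k) 0) := by
  rw [Finset.mem_Icc] at hj
  change iteratedDeriv j (fun ε : ℂ => hamiltonField V
      (taylorCurve (darbouxCurve d φ ψ t) x p ε)) 0 (Sum.inl k) = _ ∧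
    iteratedDeriv j (fun ε : ℂ => hamiltonField V
      (taylorCurve (darbouxCurve d φ ψ t) x p ε)) 0 (Sum.inr k) = _
  set c := taylorCurve d (fun i k => x i (Sum.inl k) / φ t) p with hc
  have hc0 : c 0 = d := taylorCurve_zero
  have hcan : AnalyticAt ℂ c 0 := analyticAt_taylorCurve 0
  -- The position part of the curve is φ(t) times a curve through d; homogeneity then pulls φ(t)⁻³
  -- out of the gradient.
  have hleft : ∀ ε, (fun k => taylorCurve (darbouxCurve d φ ψ t) x p ε (Sum.inl k)) =
      φ t • c ε := by
    intro ε
    ext k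
    simp only [hc, taylorCurve_apply, darbouxCurve, Sum.elim_inl, Pi.smul_apply, smul_eq_mul,
      mul_add, Finset.mul_sum]
    congr 1
    refine Finset.sum_congr rfl fun i _ => ?_
    field_simp
  have hcU : ∀ᶠ ε in 𝓝 (0 : ℂ), c ε ∈ U :=
    hcan.continuousAt.eventually (hc0.symm ▸ hU.mem_nhds hdU)
  have hinl : ∀ k, (fun ε => hamiltonField V (taylorCurve (darbouxCurve d φ ψ t) x p ε)
      (Sum.inl k)) = fun ε => taylorCurve (darbouxCurve d φ ψ t) x p ε (Sum.inr k) := fun _ => rfl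
  have hinr : ∀ k, (fun ε => hamiltonField V (taylorCurve (darbouxCurve d φ ψ t) x p ε)
      (Sum.inr k)) =ᶠ[𝓝 0] fun ε => -((φ t ^ 3)⁻¹ * gradV V (c ε) k) := by
    intro k
    filter_upwards [hcU] with ε hε
    simp only [hamiltonField, Sum.elim_inr]
    rw [hleft, gradV_smul hU hV hhom ht hε]
  have hgan : ∀ k, AnalyticAt ℂ (fun ε => gradV V (c ε) k) 0 := fun k =>
    AnalyticAt.comp (g := fun q => gradV V q k) (hc0.symm ▸ analyticAt_gradV (hV d hdU) k) hcan
  have hsmooth : ContDiffAt ℂ j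
      (fun ε => hamiltonField V (taylorCurve (darbouxCurve d φ ψ t) x p ε)) 0 := by
    rw [contDiffAt_pi]
    rintro (k | k)
    · exact (analyticAt_taylorCurve_apply (Sum.inr k) 0).contDiffAt
    · exact (analyticAt_const.mul (hgan k)).neg.contDiffAt.congr_of_eventuallyEq (hinr k)
  rw [iteratedDeriv_apply hsmooth, iteratedDeriv_apply hsmooth, hinl,
    iteratedDeriv_taylorCurve_apply hj.1, if_pos hj.2, (hinr k).iteratedDeriv_eq]
  simp

variable {γ t₀ : ℂ} {φ ψ : ℂ → ℂ} {p : ℕ} {x : ℕ → ℂ → Fin n ⊕ Fin n → ℂ}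

/-- The variational equations for `u = q / φ` and `w = φ p - ψ q`. -/
theorem IsVariationalSolution.scaled_deriv (hU : IsOpen U) (hV : AnalyticOnNhd ℂ V U)
    (hhom : ∀ s : ℂ, s ≠ 0 → ∀ q ∈ U, s • q ∈ U ∧ V (s • q) = s ^ (-2 : ℤ) * V q)
    (hdU : d ∈ U) (hφ₀ : φ t₀ ≠ 0) (hφ : ∀ᶠ t in 𝓝 t₀, HasDerivAt φ (ψ t) t)
    (hψ : ∀ᶠ t in 𝓝 t₀, HasDerivAt ψ (-γ * φ t ^ (-3 : ℤ)) t)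
    (hx : IsVariationalSolution (hamiltonField V) (darbouxCurve d φ ψ) t₀ p x)
    {j : ℕ} (hj : j ∈ Finset.Icc 1 p) (k : Fin n) :
    ∀ᶠ t in 𝓝 t₀, deriv (fun t => x j t (Sum.inl k)) t = x j t (Sum.inr k) ∧
      φ t ^ 2 / 2 * deriv (fun t => x j t (Sum.inl k) / φ t) t =
        (1 / 2) * (φ t * x j t (Sum.inr k) - ψ t * x j t (Sum.inl k)) ∧
      φ t ^ 2 / 2 * deriv (fun t => φ t * x j t (Sum.inr k) - ψ t * x j t (Sum.inl k)) t =
        (1 / 2) * (γ * (x j t (Sum.inl k) / φ t) - iteratedDeriv j (fun ε => gradV V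
          (taylorCurve d (fun i k => x i t (Sum.inl k) / φ t) p ε) k) 0) := by
  obtain ⟨hxan, hxeq⟩ := hx j hj
  filter_upwards [hxan.eventually_analyticAt, hxeq, hφ, hψ,
    hφ.self_of_nhds.continuousAt.eventually_ne hφ₀] with t hxt hxe hφt hψt ht
  obtain ⟨hl, hr⟩ := iteratedDeriv_hamiltonField hU hV hhom hdU (ψ := ψ) ht hj (fun i => x i t) k
  have hd := hasDerivAt_pi.1 hxt.differentiableAt.hasDerivAt
  have hdl := hd (Sum.inl k)
  have hdr := hd (Sum.inr k)
  rw [hxe, hl] at hdl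
  rw [hxe, hr] at hdr
  refine ⟨hdl.deriv, ?_, ?_⟩
  · rw [(hdl.fun_div hφt ht).deriv]
    field_simp
  -- The terms ψp cancel, and −ψ'q = γφ⁻³q supplies the γu.
  · rw [((hφt.fun_mul hdr).fun_sub (hψt.fun_mul hdl)).deriv]
    have hz : φ t ^ (-3 : ℤ) = (φ t ^ 3)⁻¹ := by
      rw [zpow_neg]
      norm_cast
    rw [hz]
    field_simp
    ring

theorem analyticAt_of_eventually_hasDerivAt {f f' : ℂ → ℂ} {z : ℂ}
    (h : ∀ᶠ t in 𝓝 z, HasDerivAt f (f' t) t) : AnalyticAt ℂ f z :=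
  Complex.analyticAt_iff_eventually_differentiableAt.2 (h.mono fun _ ht => ht.differentiableAt)

theorem IsVariationalSolution.analyticAt_apply {ι : Type*} [Fintype ι] {v : (ι → ℂ) → ι → ℂ}
    {x₀ : ℂ → ι → ℂ} {x : ℕ → ℂ → ι → ℂ} (hx : IsVariationalSolution v x₀ t₀ p x) {j : ℕ}
    (hj : j ∈ Finset.Icc 1 p) (i : ι) : AnalyticAt ℂ (fun t => x j t i) t₀ :=
  analyticAt_pi_iff.1 (hx j hj).1 i

/-- The germs of the functions `q_j / φ` are exponential polynomials in a primitive of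
`2 / φ ^ 2`. -/
theorem IsVariationalSolution.mem_expPoly (hU : IsOpen U) (hV : AnalyticOnNhd ℂ V U)
    (hhom : ∀ s : ℂ, s ≠ 0 → ∀ q ∈ U, s • q ∈ U ∧ V (s • q) = s ^ (-2 : ℤ) * V q)
    (hdU : d ∈ U) (hφ₀ : φ t₀ ≠ 0) (hφ : ∀ᶠ t in 𝓝 t₀, HasDerivAt φ (ψ t) t)
    (hψ : ∀ᶠ t in 𝓝 t₀, HasDerivAt ψ (-γ * φ t ^ (-3 : ℤ)) t)
    {I : ℂ → ℂ} (hI : AnalyticAt ℂ I t₀) (hI' : ∀ᶠ t in 𝓝 t₀, φ t ^ 2 / 2 * deriv I t = 1)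
    (hx : IsVariationalSolution (hamiltonField V) (darbouxCurve d φ ψ) t₀ p x)
    {j : ℕ} (hj : j ∈ Finset.Icc 1 p) (k : Fin n) :
    ∃ h : MeromorphicAt (fun t => x j t (Sum.inl k) / φ t) t₀,
      Mero.of _ h ∈ expPoly (Mero.of I hI.meromorphicAt) (Mero.expHom I hI) := by
  have hφan := analyticAt_of_eventually_hasDerivAt hφ
  have hψan := analyticAt_of_eventually_hasDerivAt hψ
  have hr : MeromorphicAt (fun t => φ t ^ 2 / 2) t₀ := (by fun_prop : AnalyticAt ℂ _ _).meromorphicAt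
  have hr0 : Mero.of _ hr ≠ 0 := by
    rintro h
    have := Mero.scaledDeriv_of_eq_one (hr := hr) hI hI'
    rw [Mero.scaledDeriv_apply, h, zero_mul] at this
    exact zero_ne_one this
  -- The Taylor coefficient lemmas concern functions of t, so the algebra is pulled back from germs
  -- to functions.
  set A := Mero.preimageSubalgebra (expPoly (Mero.of I hI.meromorphicAt) (Mero.expHom I hI))
  change (fun t => x j t (Sum.inl k) / φ t) ∈ A
  induction j using Nat.strong_induction_on generalizing k with
  | _ j ih =>
    have hu : ∀ k, MeromorphicAt (fun t => x j t (Sum.inl k) / φ t) t₀ := fun k =>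
      ((hx.analyticAt_apply hj _).meromorphicAt).div hφan.meromorphicAt
    have hw : ∀ k, MeromorphicAt
        (fun t => φ t * x j t (Sum.inr k) - ψ t * x j t (Sum.inl k)) t₀ := fun k =>
      ((hφan.mul (hx.analyticAt_apply hj _)).sub
        (hψan.mul (hx.analyticAt_apply hj _))).meromorphicAt
    set y : Fin n ⊕ Fin n → Mero t₀ :=
      Sum.elim (fun k => Mero.of _ (hu k)) (fun k => Mero.of _ (hw k))
    refine ⟨hu k, mem_expPoly_of_linear_system (Mero.scaledDeriv_of_eq_one (hr := hr) hI hI')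
      (Mero.scaledDeriv_expHom hI hI')
      (Mero.exists_algebraMap_eq_of_scaledDeriv_eq_zero hr0) y ?_ (Sum.inl k)⟩
    clear k
    have hspan : ∀ i, y i ∈ Submodule.span ℂ (Set.range y) := fun i =>
      Submodule.subset_span ⟨i, rfl⟩
    rintro (k | k)
    · refine ⟨(1 / 2 : ℂ) • y (Sum.inr k),
        Submodule.smul_mem _ _ (hspan _), ?_⟩
      have : Mero.scaledDeriv (Mero.of _ hr) (y (Sum.inl k)) = (1 / 2 : ℂ) • y (Sum.inr k) :=
        Mero.scaledDeriv_of (hf := hu k) (hg := (MeromorphicAt.const _ _).mul (hw k))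
          ((hx.scaled_deriv hU hV hhom hdU hφ₀ hφ hψ hj k).mono
          fun t ht => ht.2.1)
      rw [this, sub_self]
      exact zero_mem _
    · obtain ⟨hg, hgB⟩ := iteratedDeriv_comp_taylorCurve_sub_mem A
        (fun i t k => x i t (Sum.inl k) / φ t) (analyticAt_gradV (hV d hdU) k) hj
        fun i hi hij l => ih i hij hi l
      obtain ⟨hs, hse⟩ := Mero.sum_of Finset.univ
        (f := fun l t => fderiv ℂ (fun q => gradV V q k) d (Pi.single l 1) *
          (x j t (Sum.inl l) / φ t)) fun l => (MeromorphicAt.const _ _).mul (hu l)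
      -- The linear part is (γu − V''(d)u)/2; the rest of the Taylor coefficient involves only lower
      -- orders.
      refine ⟨(1 / 2 : ℂ) • (γ • y (Sum.inl k) - Mero.of _ hs), ?_, ?_⟩
      · refine Submodule.smul_mem _ _ (sub_mem (Submodule.smul_mem _ _
          (hspan _)) ?_)
        rw [hse]
        exact sum_mem fun l _ => Submodule.smul_mem _
          (fderiv ℂ (fun q => gradV V q k) d (Pi.single l 1)) (hspan (Sum.inl l))
      · have : Mero.scaledDeriv (Mero.of _ hr) (y (Sum.inr k)) =
            (1 / 2 : ℂ) • (γ • y (Sum.inl k) + (-1 : ℂ) • (Mero.of _ hs + Mero.of _ hg)) := by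
          refine Mero.scaledDeriv_of (hf := hw k) (hg := ((MeromorphicAt.const _ _).mul
            (((MeromorphicAt.const _ _).mul (hu k)).add
              ((MeromorphicAt.const _ _).mul (hs.add hg))))) ?_
          filter_upwards [hx.scaled_deriv hU hV hhom hdU hφ₀ hφ hψ hj k] with t ht
          rw [ht.2.2]
          simp only [Pi.add_apply, Pi.mul_apply]
          ring
        rw [this, ← smul_sub]
        refine Subalgebra.smul_mem _ ?_ _
        have e : γ • y (Sum.inl k) + (-1 : ℂ) • (Mero.of _ hs + Mero.of _ hg) -
            (γ • y (Sum.inl k) - Mero.of _ hs) = (-1 : ℂ) • Mero.of _ hg := by module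
        rw [e]
        exact Subalgebra.smul_mem _ hgB _

end Homogeneous

/-! ### From germs back to functions, and the theorem. -/

/-- A germ of an analytic function has a primitive. -/
theorem AnalyticAt.exists_primitive {f : ℂ → ℂ} {z : ℂ} (hf : AnalyticAt ℂ f z) :
    ∃ F : ℂ → ℂ, ∀ᶠ t in 𝓝 z, HasDerivAt F (f t) t := by
  obtain ⟨ε, hε, h⟩ := Metric.eventually_nhds_iff_ball.1 hf.eventually_analyticAt
  obtain ⟨F, hF⟩ := DifferentiableOn.isExactOn_ball (c := z) (r := ε) (f := f)
    fun t ht => (h t ht).differentiableAt.differentiableWithinAt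
  exact ⟨F, Filter.mem_of_superset (Metric.ball_mem_nhds z hε) hF⟩

/-- Germs ignore the centre z; analyticity of both sides restores equality there. -/
theorem exists_logExpSpan_eq_of_mem_expPoly {I u : ℂ → ℂ} {z : ℂ} (hI : AnalyticAt ℂ I z)
    (hu : AnalyticAt ℂ u z)
    (h : Mero.of u hu.meromorphicAt ∈ expPoly (Mero.of I hI.meromorphicAt) (Mero.expHom I hI)) :
    ∃ b ∈ logExpSpan I, u =ᶠ[𝓝 z] b := by
  obtain ⟨b, hb, hban, e⟩ := Mero.exists_logExpSpan_of_mem_expPoly hI h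
  exact ⟨b, hb, (hu.frequently_eq_iff_eventually_eq hban).1 (Mero.of_eq_of.1 e).frequently⟩

end

theorem theorem1p3 {n : ℕ}
    -- a potential, holomorphic and homogeneous of degree `-2` on an open cone `U`
    (U : Set (Fin n → ℂ)) (hU : IsOpen U)
    (V : (Fin n → ℂ) → ℂ) (hV : AnalyticOnNhd ℂ V U)
    (hhom : ∀ s : ℂ, s ≠ 0 → ∀ q ∈ U, s • q ∈ U ∧ V (s • q) = s ^ (-2 : ℤ) * V q)
    -- a proper Darboux point
    (d : Fin n → ℂ) (hdU : d ∈ U) (hd : d ≠ 0)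
    (γ : ℂ) (hγ : γ ≠ 0) (hdγ : gradV V d = γ • d)
    -- a solution `(φ d, ψ d)` of Hamilton's equations near `t₀`
    (t₀ : ℂ) (φ ψ : ℂ → ℂ) (hφ₀ : φ t₀ ≠ 0)
    (hφ : ∀ᶠ t in 𝓝 t₀, HasDerivAt φ (ψ t) t)
    (hψ : ∀ᶠ t in 𝓝 t₀, HasDerivAt ψ (-γ * φ t ^ (-3 : ℤ)) t)
    (p : ℕ) :
    (∀ σ ∈ diffGaloisGroup (phaseCurveField t₀ φ ψ)
        (variationalField (hamiltonField V) (darbouxCurve d φ ψ) t₀ (phaseCurveField t₀ φ ψ) p),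
      ∀ τ ∈ diffGaloisGroup (phaseCurveField t₀ φ ψ)
        (variationalField (hamiltonField V) (darbouxCurve d φ ψ) t₀ (phaseCurveField t₀ φ ψ) p),
      σ * τ = τ * σ) ∧
    (∀ I : ℂ → ℂ, (∀ᶠ t in 𝓝 t₀, HasDerivAt I (2 / φ t ^ 2) t) →
      ∀ x : ℕ → ℂ → Fin n ⊕ Fin n → ℂ,
        IsVariationalSolution (hamiltonField V) (darbouxCurve d φ ψ) t₀ p x →
        ∀ j ∈ Finset.Icc 1 p, ∀ i : Fin n, ∃ b ∈ logExpSpan I,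
          ∀ᶠ t in 𝓝 t₀, x j t (Sum.inl i) = φ t * b t) := by
  have hφan := analyticAt_of_eventually_hasDerivAt hφ
  have hφne : ∀ᶠ t in 𝓝 t₀, φ t ≠ 0 := hφan.continuousAt.eventually_ne hφ₀
  have hprim : ∀ I : ℂ → ℂ, (∀ᶠ t in 𝓝 t₀, HasDerivAt I (2 / φ t ^ 2) t) →
      ∀ᶠ t in 𝓝 t₀, φ t ^ 2 / 2 * deriv I t = 1 := by
    intro I hI
    filter_upwards [hI, hφne] with t ht hφt
    rw [ht.deriv]
    field_simp
  refine ⟨fun σ hσ τ hτ => ?_, fun I hI x hx j hj i => ?_⟩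
  -- I serves only to find the finite-dimensional D-stable spaces; it is not claimed to lie in the
  -- extension.
  · obtain ⟨I, hI⟩ := AnalyticAt.exists_primitive (f := fun t => 2 / φ t ^ 2)
      (analyticAt_const.div (hφan.pow 2) (pow_ne_zero 2 hφ₀))
    have hIan := analyticAt_of_eventually_hasDerivAt hI
    have hr : MeromorphicAt (fun t => φ t ^ 2 / 2) t₀ :=
      (by fun_prop : AnalyticAt ℂ _ _).meromorphicAt
    have hφK : Mero.of φ hφan.meromorphicAt ∈ phaseCurveField t₀ φ ψ :=
      IntermediateField.subset_adjoin _ _ ⟨φ, by simp, rfl⟩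
    have hrK : Mero.of _ hr ∈ phaseCurveField t₀ φ ψ := by
      have : Mero.of _ hr = (1 / 2 : ℂ) • Mero.of φ hφan.meromorphicAt ^ 2 := by
        rw [Mero.pow_of, Mero.smul_of, Mero.of_eq_of]
        exact Eventually.of_forall fun t => by ring
      rw [this]
      exact IntermediateField.smul_mem _ (pow_mem hφK 2)
    have hone := Mero.scaledDeriv_of_eq_one (hr := hr) hIan (hprim I hI)
    have hr0 : Mero.of _ hr ≠ 0 := by
      rintro h
      rw [Mero.scaledDeriv_apply, h, zero_mul] at hone
      exact zero_ne_one hone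
    refine diffGaloisGroup_commute (phaseCurveField t₀ φ ψ) hrK
      (Mero.scaledDeriv_apply (Mero.of _ hr))
      (Mero.exists_algebraMap_eq_of_scaledDeriv_eq_zero hr0) ?_ hσ hτ
    rintro s ⟨_, ⟨x, hx, j, hj, i, rfl⟩, hs⟩
    have hkey : ∀ k : Fin n, ∃ hu : MeromorphicAt (fun t => x j t (Sum.inl k) / φ t) t₀,
        Mero.of _ hu ∈ variationalField (hamiltonField V) (darbouxCurve d φ ψ) t₀
          (phaseCurveField t₀ φ ψ) p ∧
        (∃ N : Submodule ℂ (Mero t₀), FiniteDimensional ℂ N ∧ Mero.of _ hu ∈ N ∧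
          ∀ z ∈ N, Mero.scaledDeriv (Mero.of _ hr) z ∈ N) ∧
        Mero.of φ hφan.meromorphicAt * Mero.of _ hu =
          Mero.of (fun t => x j t (Sum.inl k)) (hx.analyticAt_apply hj _).meromorphicAt := by
      intro k
      obtain ⟨hu, huB⟩ := hx.mem_expPoly hU hV hhom hdU hφ₀ hφ hψ hIan (hprim I hI) hj k
      have hmul : Mero.of φ hφan.meromorphicAt * Mero.of _ hu =
          Mero.of (fun t => x j t (Sum.inl k)) (hx.analyticAt_apply hj _).meromorphicAt := by
        rw [Mero.mul_of]
        refine Mero.of_congr ?_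
        filter_upwards [hφne] with t ht
        exact mul_div_cancel₀ _ ht
      have hφ0 : Mero.of φ hφan.meromorphicAt ≠ 0 := by
        intro h
        rw [Mero.zero_eq_of, Mero.of_eq_of] at h
        obtain ⟨t, h1, h2⟩ := (h.and (hφne.filter_mono nhdsWithin_le_nhds)).exists
        exact h2 h1
      refine ⟨hu, ?_, exists_finiteDimensional_of_mem_expPoly hone
        (Mero.scaledDeriv_expHom hIan (hprim I hI)) huB, hmul⟩
      -- u = φ⁻¹q, with φ in K and q among the generators.
      rw [← inv_mul_cancel_left₀ hφ0 (Mero.of _ hu), hmul]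
      exact mul_mem (inv_mem ((variationalField (hamiltonField V) (darbouxCurve d φ ψ) t₀
          (phaseCurveField t₀ φ ψ) p).algebraMap_mem ⟨_, hφK⟩))
        (subset_diffAdjoin _ _ ⟨_, ⟨x, hx, j, hj, Sum.inl k, rfl⟩, rfl⟩)
    -- A position component is φu, and a momentum component is (φu)'.
    rcases i with k | k
    · obtain ⟨hu, huL, hN, hmul⟩ := hkey k
      exact ⟨_, huL, hN, _, hφK, Or.inl (by rw [hmul]; exact Subtype.ext hs)⟩
    · obtain ⟨hu, huL, hN, hmul⟩ := hkey k
      refine ⟨_, huL, hN, _, hφK, Or.inr ?_⟩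
      rw [hmul, Mero.deriv_of]
      refine (Subtype.ext hs : s = Mero.of _ (hx.analyticAt_apply hj _).meromorphicAt).trans
        (Mero.of_congr ?_)
      exact (hx.scaled_deriv hU hV hhom hdU hφ₀ hφ hψ hj k).mono fun t ht => ht.1.symm
  · have hIan := analyticAt_of_eventually_hasDerivAt hI
    have hu : AnalyticAt ℂ (fun t => x j t (Sum.inl i) / φ t) t₀ :=
      (hx.analyticAt_apply hj _).div hφan hφ₀
    obtain ⟨_, huB⟩ := hx.mem_expPoly hU hV hhom hdU hφ₀ hφ hψ hIan (hprim I hI) hj i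
    obtain ⟨b, hb, h⟩ := exists_logExpSpan_eq_of_mem_expPoly hIan hu huB
    refine ⟨b, hb, ?_⟩
    filter_upwards [h, hφne] with t ht hφt
    rw [← ht, mul_div_cancel₀ _ hφt]
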